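/- Let $n\ge 2$, let $\Omega\subset\mathbb{R}^n$ be a domain (non-empty, open and connected), and let $E\subset\Omega$ be closed in $\Omega$ with $(n-1)$-dimensional Hausdorff measure $\mathcal{H}^{n-1}(E)=0$. Let $u:\Omega\setminus E\to\mathbb{R}$ be subharmonic and such that (i) $u\in\mathcal{L}^1_{\mathrm{loc}}(\Omega)$; (ii) $u\in\mathcal{C}^2(\Omega\setminus E)$; (iii) for each $j$, $1\le j\le n$, the (classical) second partial derivative $\frac{\partial^2u}{\partial x_j^2}$, defined on $\Omega\setminus E$, belongs to $\mathcal{L}^1_{\mathrm{loc}}(\Omega)$. Then $u$ has a subharmonic extension to $\Omega$, that is, there is a subharmonic function $v:\Omega\to[-\infty,\infty)$ with $v=u$ on $\Omega\setminus E$. Here a function $f:U\to[-\infty,\infty)$ on an open set $U\subset\mathbb{R}^n$ is called subharmonic if it is upper semicontinuous, is not identically $-\infty$ on any connected component of $U$, and satisfies $f(x)\le\frac{1}{|B|}\int_B f(y)\,dy$ for every closed ball $B\subset U$ of positive radius and centre $x$. In (i) and (iii), a function $g$ defined on $\Omega\setminus E$ belongs to $\mathcal{L}^1_{\mathrm{loc}}(\Omega)$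 if every point of $\Omega$ has a neighbourhood $V\subset\Omega$ with $\int_{V\setminus E}|g|\,dx<\infty$ (the set $E$ has Lebesgue measure zero). -/

import Mathlib

open MeasureTheory

noncomputable section

/-- The integral `∫ f⁺ dμ - ∫ f⁻ dμ` of an extended-real-valued function. It has its usual meaning
as soon as one of the two terms is finite; this is always so for an upper semicontinuous function
with values in `[-∞, ∞)` on a closed ball, since such a function is bounded above there. -/
def extIntegral {X : Type*} [MeasurableSpace X] (μ : Measure X) (f : X → EReal) : EReal :=
  ((∫⁻ y, (f y).toENNReal ∂μ : ENNReal) : EReal) - ((∫⁻ y, (-f y).toENNReal ∂μ : ENNReal) : EReal)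

/-- The mean value of `f` over the closed ball with centre `x` and radius `r`, with respect to
Lebesgue measure. -/
def ballMean {n : ℕ} (f : EuclideanSpace ℝ (Fin n) → EReal) (x : EuclideanSpace ℝ (Fin n))
    (r : ℝ) : EReal :=
  extIntegral (volume.restrict (Metric.closedBall x r)) f /
    ((volume.real (Metric.closedBall x r) : ℝ) : EReal)

/-- `f` is subharmonic on the open set `U`: on `U` it takes values in `[-∞, ∞)`, is upper
semicontinuous, is bounded at each `x ∈ U` by its means over all closed balls in `U` centred at `x`,
and is not identically `-∞` on any connected component of `U`. Only the values of `f` on `U`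
matter. -/
structure SubharmonicOn {n : ℕ} (f : EuclideanSpace ℝ (Fin n) → EReal)
    (U : Set (EuclideanSpace ℝ (Fin n))) : Prop where
  lt_top : ∀ x ∈ U, f x < ⊤
  upperSemicontinuousOn : UpperSemicontinuousOn f U
  le_ballMean : ∀ x ∈ U, ∀ r : ℝ, 0 < r → Metric.closedBall x r ⊆ U → f x ≤ ballMean f x r
  exists_ne_bot : ∀ x ∈ U, ∃ y ∈ connectedComponentIn U x, f y ≠ ⊥

/-- The first partial derivative `∂f/∂x_j`. -/
def partialDeriv {n : ℕ} (j : Fin n) (f : EuclideanSpace ℝ (Fin n) → ℝ) :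
    EuclideanSpace ℝ (Fin n) → ℝ :=
  fun x => lineDeriv ℝ f x (EuclideanSpace.single j (1 : ℝ))

end

/-!
Almost every line parallel to a coordinate axis misses a set of vanishing `(n-1)`-dimensional
Hausdorff measure, because the projection of the set along the axis is Lebesgue null. Integrating by
parts twice on these lines shows that the classical second partial derivatives of `u` on `Ω \ E`
are its distributional ones on all of `Ω`. Since `u` is subharmonic and `C²` off `E`, their sum is
nonnegative there, so `u` has nonnegative distributional Laplacian on `Ω`.

The derivative in `t` of the kernel `t⁻ᵈ η(‖y - x‖² / t²)` is a positive multiple of the Laplacian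
of a test function supported in the closed ball of radius `t` around `x`. Letting `η` approach the
indicator function of `[0, 1)`, one sees that the averages of `u` over the balls centred at `x`
increase with the radius. Their infimum is upper semicontinuous in `x`, and it equals `u x` wherever
the averages converge to `u x`: at the Lebesgue points of `u`, which yields the sub-mean value
inequality, and at the points of `Ω \ E`, where `u` is continuous.
-/

open Set Filter Metric Topology InnerProductSpace Laplacian

section LineDeriv

variable {V : Type*} [NormedAddCommGroup V] [NormedSpace ℝ V]

theorem tsupport_lineDeriv_subset (f : V → ℝ) (v : V) :
    tsupport (fun x => lineDeriv ℝ f x v) ⊆ tsupport f := by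
  refine closure_minimal (fun x hx => ?_) (isClosed_tsupport f)
  contrapose hx
  have hzero : lineDeriv ℝ f x v = lineDeriv ℝ (fun _ => (0 : ℝ)) x v :=
    (notMem_tsupport_iff_eventuallyEq.1 hx).lineDeriv_eq
  simpa [lineDeriv] using hzero

theorem contDiffOn_lineDeriv {f : V → ℝ} {U : Set V} {k : WithTop ℕ∞} (hU : IsOpen U)
    (hf : ContDiffOn ℝ (k + 1) f U) (v : V) : ContDiffOn ℝ k (fun x => lineDeriv ℝ f x v) U :=
  ((hf.fderiv_of_isOpen hU le_rfl).clm_apply contDiffOn_const).congr fun _ hx =>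
    ((hf.differentiableOn (by simp)).differentiableAt (hU.mem_nhds hx)).lineDeriv_eq_fderiv

theorem contDiff_lineDeriv {f : V → ℝ} {k : WithTop ℕ∞} (hf : ContDiff ℝ (k + 1) f) (v : V) :
    ContDiff ℝ k fun x => lineDeriv ℝ f x v :=
  contDiffOn_univ.1 (contDiffOn_lineDeriv isOpen_univ (contDiffOn_univ.2 hf) v)

theorem continuousOn_lineDeriv_lineDeriv {f : V → ℝ} {U : Set V} (hU : IsOpen U)
    (hf : ContDiffOn ℝ 2 f U) (v : V) :
    ContinuousOn (fun x => lineDeriv ℝ (fun y => lineDeriv ℝ f y v) x v) U := by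
  have hf' : ContDiffOn ℝ (0 + 1 + 1) f U := by norm_num; exact hf
  exact (contDiffOn_lineDeriv hU (contDiffOn_lineDeriv hU hf' v) v).continuousOn

theorem lineDeriv_lineDeriv_eq_iteratedFDeriv {f : V → ℝ} {x : V} (hf : ContDiffAt ℝ 2 f x)
    (v : V) : lineDeriv ℝ (fun y => lineDeriv ℝ f y v) x v = iteratedFDeriv ℝ 2 f x ![v, v] := by
  have hfderiv : (fun y => lineDeriv ℝ f y v) =ᶠ[𝓝 x] fun y => fderiv ℝ f y v := by
    filter_upwards [hf.eventually (by simp)] with y hy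
    exact (hy.differentiableAt (by simp)).lineDeriv_eq_fderiv
  have hdiff : DifferentiableAt ℝ (fderiv ℝ f) x :=
    (hf.fderiv_right (m := 1) (by norm_num)).differentiableAt (by simp)
  rw [hfderiv.lineDeriv_eq, (hdiff.clm_apply (differentiableAt_const v)).lineDeriv_eq_fderiv,
    iteratedFDeriv_two_apply, fderiv_clm_apply hdiff (differentiableAt_const v)]
  simp

end LineDeriv

section IntegrationByParts

theorem integrable_mul_of_tsupport_subset {X : Type*} [TopologicalSpace X] [T2Space X]
    [MeasurableSpace X] [OpensMeasurableSpace X] {μ : Measure X} {f g : X → ℝ} {Ω : Set X}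
    (hf : LocallyIntegrableOn f Ω μ) (hg : Continuous g) (hc : HasCompactSupport g)
    (hsub : tsupport g ⊆ Ω) : Integrable (fun x => f x * g x) μ := by
  have hint := (hf.integrableOn_compact_subset hsub hc).mul_continuousOn hg.continuousOn hc
  refine (integrableOn_iff_integrable_of_support_subset fun x hx => ?_).1 hint
  exact subset_tsupport g (right_ne_zero_of_mul hx)

theorem integrable_mul_lineDeriv_lineDeriv {V : Type*} [NormedAddCommGroup V] [NormedSpace ℝ V]
    [MeasurableSpace V] [OpensMeasurableSpace V] {μ : Measure V} {f φ : V → ℝ} {Ω : Set V}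
    (hf : LocallyIntegrableOn f Ω μ) (hφ : ContDiff ℝ 2 φ) (hc : HasCompactSupport φ)
    (hsub : tsupport φ ⊆ Ω) (v : V) :
    Integrable (fun x => f x * lineDeriv ℝ (fun y => lineDeriv ℝ φ y v) x v) μ := by
  have hsub2 : tsupport (fun x => lineDeriv ℝ (fun y => lineDeriv ℝ φ y v) x v) ⊆ tsupport φ :=
    (tsupport_lineDeriv_subset _ v).trans (tsupport_lineDeriv_subset φ v)
  have hcont : Continuous fun x => lineDeriv ℝ (fun y => lineDeriv ℝ φ y v) x v :=
    continuousOn_univ.1 (continuousOn_lineDeriv_lineDeriv isOpen_univ hφ.contDiffOn v)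
  exact integrable_mul_of_tsupport_subset hf hcont
    (hc.mono' ((subset_tsupport _).trans hsub2)) (hsub2.trans hsub)

variable {V : Type*} [NormedAddCommGroup V] [NormedSpace ℝ V] [FiniteDimensional ℝ V]
  [MeasurableSpace V] [BorelSpace V] {μ : Measure V} [μ.IsAddHaarMeasure]

theorem integral_mul_lineDeriv_of_tsupport_subset {f g : V → ℝ} {Ω : Set V} (hΩ : IsOpen Ω)
    (hf : ContDiffOn ℝ 1 f Ω) (hg : ContDiff ℝ 1 g) (hc : HasCompactSupport g)
    (hsub : tsupport g ⊆ Ω) (v : V) :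
    ∫ x, f x * lineDeriv ℝ g x v ∂μ = -∫ x, lineDeriv ℝ f x v * g x ∂μ := by
  have hfd : ∀ x ∈ Ω, DifferentiableAt ℝ f x := fun x hx =>
    (hf.differentiableOn (by simp)).differentiableAt (hΩ.mem_nhds hx)
  have hf' := contDiffOn_lineDeriv (k := 0) hΩ (by simpa using hf) v
  have hg' := contDiff_lineDeriv (k := 0) (by simpa using hg) v
  have hsub' := tsupport_lineDeriv_subset g v
  have hloc : LocallyIntegrableOn f Ω μ := hf.continuousOn.locallyIntegrableOn hΩ.measurableSet
  have hloc' : LocallyIntegrableOn (fun x => lineDeriv ℝ f x v) Ω μ :=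
    hf'.continuousOn.locallyIntegrableOn hΩ.measurableSet
  have hparts := integral_bilinear_hasLineDerivAt_right_eq_neg_left_of_integrable
    (B := ContinuousLinearMap.mul ℝ ℝ) (v := v)
    (integrable_mul_of_tsupport_subset hloc' hg.continuous hc hsub)
    (integrable_mul_of_tsupport_subset hloc hg'.continuous
      (hc.mono' ((subset_tsupport _).trans hsub')) (hsub'.trans hsub))
    (integrable_mul_of_tsupport_subset hloc hg.continuous hc hsub)
    (fun x hx => (hfd x (hsub hx)).lineDifferentiableAt.hasLineDerivAt)
    (fun x _ => (hg.differentiable (by simp) x).lineDifferentiableAt.hasLineDerivAt)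
  simpa using hparts

theorem integral_mul_lineDeriv_lineDeriv {f φ : V → ℝ} {Ω : Set V} (hΩ : IsOpen Ω)
    (hf : ContDiffOn ℝ 2 f Ω) (hφ : ContDiff ℝ 2 φ) (hc : HasCompactSupport φ)
    (hsub : tsupport φ ⊆ Ω) (v : V) :
    ∫ x, f x * lineDeriv ℝ (fun y => lineDeriv ℝ φ y v) x v ∂μ =
      ∫ x, lineDeriv ℝ (fun y => lineDeriv ℝ f y v) x v * φ x ∂μ := by
  have hsub' := tsupport_lineDeriv_subset φ v
  have hf' : ContDiffOn ℝ 1 (fun x => lineDeriv ℝ f x v) Ω :=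
    contDiffOn_lineDeriv hΩ (by norm_num; exact hf) v
  have hφ' : ContDiff ℝ 1 fun x => lineDeriv ℝ φ x v :=
    contDiff_lineDeriv (by norm_num; exact hφ) v
  rw [integral_mul_lineDeriv_of_tsupport_subset hΩ (hf.of_le one_le_two) hφ'
      (hc.mono' ((subset_tsupport _).trans hsub')) (hsub'.trans hsub),
    integral_mul_lineDeriv_of_tsupport_subset hΩ hf' (hφ.of_le one_le_two) hc hsub, neg_neg]

end IntegrationByParts

section CoordinateLines

variable {m : ℕ} (j : Fin (m + 1))

/-- The line in `ℝᵐ⁺¹` parallel to the `j`-th coordinate axis, parametrised by its `j`-th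
coordinate `t`; the remaining coordinates are given by `y`. -/
noncomputable def coordLine (y : Fin m → ℝ) (t : ℝ) : EuclideanSpace ℝ (Fin (m + 1)) :=
  WithLp.toLp 2 (Fin.insertNth (α := fun _ => ℝ) j t y)

theorem coordLine_add (y : Fin m → ℝ) (t s : ℝ) :
    coordLine j y (t + s) = coordLine j y t + s • EuclideanSpace.single j (1 : ℝ) := by
  ext i
  refine Fin.succAboveCases j ?_ (fun i => ?_) i <;> simp [coordLine]

theorem contDiff_coordLine (y : Fin m → ℝ) {k : WithTop ℕ∞} : ContDiff ℝ k (coordLine j y) := by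
  have hline : coordLine j y =
      fun t => coordLine j y 0 + t • EuclideanSpace.single j (1 : ℝ) := by
    ext1 t
    rw [← coordLine_add, zero_add]
  rw [hline]
  fun_prop

theorem isClosedEmbedding_coordLine (y : Fin m → ℝ) : IsClosedEmbedding (coordLine j y) := by
  have hleft : Function.LeftInverse (fun x : EuclideanSpace ℝ (Fin (m + 1)) => x j)
      (coordLine j y) := fun t => by simp [coordLine]
  exact hleft.isClosedEmbedding (by fun_prop) (contDiff_coordLine (k := 0) j y).continuous

theorem lineDeriv_comp_coordLine (f : EuclideanSpace ℝ (Fin (m + 1)) → ℝ) (y : Fin m → ℝ)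
    (t : ℝ) :
    lineDeriv ℝ (fun s => f (coordLine j y s)) t 1 = partialDeriv j f (coordLine j y t) := by
  simp only [partialDeriv, lineDeriv, coordLine_add, smul_eq_mul, mul_one]

theorem ae_forall_coordLine_notMem {E : Set (EuclideanSpace ℝ (Fin (m + 1)))}
    (hE : Measure.hausdorffMeasure (m : ℝ) E = 0) :
    ∀ᵐ y : Fin m → ℝ, ∀ t, coordLine j y t ∉ E := by
  let P : EuclideanSpace ℝ (Fin (m + 1)) → Fin m → ℝ := fun x i => x (j.succAbove i)
  have hP : LipschitzWith 1 P := LipschitzWith.of_dist_le_mul fun x y => by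
    rw [NNReal.coe_one, one_mul, dist_pi_le_iff dist_nonneg]
    exact fun i => by simpa [dist_eq_norm] using PiLp.norm_apply_le (x - y) (j.succAbove i)
  have hPE : volume (P '' E) = 0 := by
    have hle := hP.hausdorffMeasure_image_le (Nat.cast_nonneg m) E
    rw [hE, mul_zero, nonpos_iff_eq_zero] at hle
    rwa [← hausdorffMeasure_pi_real, Fintype.card_fin]
  filter_upwards [measure_eq_zero_iff_ae_notMem.1 hPE] with y hy t ht
  refine hy ⟨_, ht, ?_⟩
  ext i
  simp [P, coordLine]

theorem integral_eq_integral_coordLine {f : EuclideanSpace ℝ (Fin (m + 1)) → ℝ}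
    (hf : Integrable f) : ∫ x, f x = ∫ y : Fin m → ℝ, ∫ t : ℝ, f (coordLine j y t) := by
  let e : EuclideanSpace ℝ (Fin (m + 1)) ≃ᵐ ℝ × (Fin m → ℝ) :=
    (MeasurableEquiv.toLp 2 (Fin (m + 1) → ℝ)).symm.trans
      (MeasurableEquiv.piFinSuccAbove (fun _ => ℝ) j)
  have he : MeasurePreserving e.symm (volume.prod volume) volume :=
    ((EuclideanSpace.volume_preserving_symm_measurableEquiv_toLp (Fin (m + 1))).trans
      (volume_preserving_piFinSuccAbove (fun _ => ℝ) j)).symm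
  rw [← he.integral_comp' f]
  exact integral_prod_symm _ ((he.integrable_comp_emb e.symm.measurableEmbedding).2 hf)

theorem integral_mul_partialDeriv_partialDeriv_comp_coordLine
    {Ω : Set (EuclideanSpace ℝ (Fin (m + 1)))} {f φ : EuclideanSpace ℝ (Fin (m + 1)) → ℝ}
    (y : Fin m → ℝ) {U : Set (EuclideanSpace ℝ (Fin (m + 1)))} (hΩ : IsOpen Ω)
    (hf : ContDiffOn ℝ 2 f U) (hy : coordLine j y ⁻¹' Ω ⊆ coordLine j y ⁻¹' U)
    (hφ : ContDiff ℝ 2 φ) (hc : HasCompactSupport φ) (hsub : tsupport φ ⊆ Ω) :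
    ∫ t, f (coordLine j y t) * partialDeriv j (partialDeriv j φ) (coordLine j y t) =
      ∫ t, partialDeriv j (partialDeriv j f) (coordLine j y t) * φ (coordLine j y t) := by
  have hl : ContDiff ℝ 2 (coordLine j y) := contDiff_coordLine j y
  have hparts := integral_mul_lineDeriv_lineDeriv (μ := volume) (hΩ.preimage hl.continuous)
    ((hf.comp hl.contDiffOn (mapsTo_preimage _ _)).mono hy) (hφ.comp hl)
    (hc.comp_isClosedEmbedding (isClosedEmbedding_coordLine j y))
    ((tsupport_comp_subset_preimage φ hl.continuous).trans (preimage_mono hsub)) 1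
  simpa only [Function.comp_def, lineDeriv_comp_coordLine] using hparts

end CoordinateLines

section RemovableSet

variable {n : ℕ}

theorem integral_mul_partialDeriv_partialDeriv (j : Fin n) {Ω E : Set (EuclideanSpace ℝ (Fin n))}
    (hΩ : IsOpen Ω) (hE : Measure.hausdorffMeasure ((n : ℝ) - 1) E = 0)
    {u φ : EuclideanSpace ℝ (Fin n) → ℝ} (hu : LocallyIntegrableOn u Ω)
    (hu2 : ContDiffOn ℝ 2 u (Ω \ E))
    (hu3 : LocallyIntegrableOn (partialDeriv j (partialDeriv j u)) Ω)
    (hφ : ContDiff ℝ 2 φ) (hc : HasCompactSupport φ) (hsub : tsupport φ ⊆ Ω) :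
    ∫ x, u x * partialDeriv j (partialDeriv j φ) x =
      ∫ x, partialDeriv j (partialDeriv j u) x * φ x := by
  obtain ⟨m, rfl⟩ := Nat.exists_eq_add_one_of_ne_zero j.pos.ne'
  rw [Nat.cast_add_one, add_sub_cancel_right] at hE
  have hint : Integrable fun x => u x * partialDeriv j (partialDeriv j φ) x :=
    integrable_mul_lineDeriv_lineDeriv hu hφ hc hsub (EuclideanSpace.single j (1 : ℝ))
  rw [integral_eq_integral_coordLine j hint, integral_eq_integral_coordLine j
    (integrable_mul_of_tsupport_subset hu3 hφ.continuous hc hsub)]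
  refine integral_congr_ae ?_
  filter_upwards [ae_forall_coordLine_notMem j hE] with y hy
  exact integral_mul_partialDeriv_partialDeriv_comp_coordLine j y hΩ hu2
    (fun t ht => ⟨ht, hy t⟩) hφ hc hsub

end RemovableSet

section Laplacian

variable {V : Type*} [NormedAddCommGroup V] [InnerProductSpace ℝ V] [FiniteDimensional ℝ V]

theorem laplacian_eq_sum_lineDeriv {ι : Type*} [Fintype ι] (b : OrthonormalBasis ι ℝ V)
    {f : V → ℝ} {x : V} (hf : ContDiffAt ℝ 2 f x) :
    Δ f x = ∑ i, lineDeriv ℝ (fun y => lineDeriv ℝ f y (b i)) x (b i) := by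
  simp only [laplacian_eq_iteratedFDeriv_orthonormalBasis f b,
    lineDeriv_lineDeriv_eq_iteratedFDeriv hf]

theorem laplacian_eq_sum_partialDeriv {n : ℕ} {f : EuclideanSpace ℝ (Fin n) → ℝ}
    {x : EuclideanSpace ℝ (Fin n)} (hf : ContDiffAt ℝ 2 f x) :
    Δ f x = ∑ j, partialDeriv j (partialDeriv j f) x := by
  simp only [laplacian_eq_sum_lineDeriv (EuclideanSpace.basisFun (Fin n) ℝ) hf,
    EuclideanSpace.basisFun_apply]
  rfl

theorem continuousAt_laplacian {f : V → ℝ} {x : V} (hf : ContDiffAt ℝ 2 f x) :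
    ContinuousAt (Δ f) x := by
  have hcont : ContinuousAt (iteratedFDeriv ℝ 2 f) x := hf.continuousAt_iteratedFDeriv le_rfl
  rw [laplacian_eq_iteratedFDeriv_stdOrthonormalBasis]
  exact tendsto_finsetSum _ fun i _ => hcont.eval_const _

theorem tsupport_laplacian_subset (f : V → ℝ) : tsupport (Δ f) ⊆ tsupport f := by
  refine closure_minimal (fun x hx => ?_) (isClosed_tsupport f)
  contrapose hx
  have hzero : iteratedFDeriv ℝ 2 f x = 0 := by
    by_contra h
    exact hx (support_iteratedFDeriv_subset 2 h)
  simp [laplacian_eq_iteratedFDeriv_stdOrthonormalBasis, hzero]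

end Laplacian

theorem measure_eq_zero_of_hausdorffMeasure_eq_zero {V : Type*} [NormedAddCommGroup V]
    [NormedSpace ℝ V] [FiniteDimensional ℝ V] [MeasurableSpace V] [BorelSpace V] {μ : Measure V}
    [μ.IsAddHaarMeasure] {E : Set V} {d : ℝ} (hd : d ≤ Module.finrank ℝ V)
    (hE : Measure.hausdorffMeasure d E = 0) : μ E = 0 := by
  have hfinrank : Measure.hausdorffMeasure (Module.finrank ℝ V : ℝ) E = 0 :=
    le_antisymm ((Measure.hausdorffMeasure_mono hd E).trans hE.le) bot_le
  exact Measure.absolutelyContinuous_isAddHaarMeasure μ _ hfinrank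

section WeaklySubharmonic

variable {V : Type*} [NormedAddCommGroup V] [InnerProductSpace ℝ V] [FiniteDimensional ℝ V]
  [MeasurableSpace V] [BorelSpace V] {f : V → ℝ} {Ω : Set V}

/-- `f` has nonnegative distributional Laplacian on `Ω`. For locally integrable `f`,
testing with `C²` instead of smooth functions makes no difference, by mollification. -/
def WeaklySubharmonicOn (f : V → ℝ) (Ω : Set V) : Prop :=
  ∀ φ : V → ℝ, ContDiff ℝ 2 φ → HasCompactSupport φ → tsupport φ ⊆ Ω → (∀ x, 0 ≤ φ x) →
    0 ≤ ∫ x, f x * Δ φ x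

theorem weaklySubharmonicOn_of_integral_mul_lineDeriv_lineDeriv {ι : Type*} [Fintype ι]
    (b : OrthonormalBasis ι ℝ V) {g : ι → V → ℝ} (hf : LocallyIntegrableOn f Ω)
    (hg : ∀ i, LocallyIntegrableOn (g i) Ω)
    (hfg : ∀ i (φ : V → ℝ), ContDiff ℝ 2 φ → HasCompactSupport φ → tsupport φ ⊆ Ω →
      ∫ x, f x * lineDeriv ℝ (fun y => lineDeriv ℝ φ y (b i)) x (b i) = ∫ x, g i x * φ x)
    (hnonneg : ∀ᵐ x, x ∈ Ω → 0 ≤ ∑ i, g i x) : WeaklySubharmonicOn f Ω := by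
  intro φ hφ hc hsub hφ0
  have hparts : ∫ x, f x * Δ φ x = ∫ x, (∑ i, g i x) * φ x := by
    simp only [laplacian_eq_sum_lineDeriv b hφ.contDiffAt, Finset.mul_sum, Finset.sum_mul]
    rw [integral_finsetSum _ fun i _ => integrable_mul_lineDeriv_lineDeriv hf hφ hc hsub (b i),
      integral_finsetSum _ fun i _ =>
        integrable_mul_of_tsupport_subset (hg i) hφ.continuous hc hsub]
    exact Finset.sum_congr rfl fun i _ => hfg i φ hφ hc hsub
  rw [hparts]
  refine integral_nonneg_of_ae ?_
  filter_upwards [hnonneg] with x hx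
  by_cases hxΩ : x ∈ Ω
  · exact mul_nonneg (hx hxΩ) (hφ0 x)
  · simp [image_eq_zero_of_notMem_tsupport fun h => hxΩ (hsub h)]

theorem weaklySubharmonicOn_of_laplacian_nonneg (hΩ : IsOpen Ω) (hf : ContDiffOn ℝ 2 f Ω)
    (hnonneg : ∀ x ∈ Ω, 0 ≤ Δ f x) : WeaklySubharmonicOn f Ω := by
  refine weaklySubharmonicOn_of_integral_mul_lineDeriv_lineDeriv (stdOrthonormalBasis ℝ V)
    (hf.continuousOn.locallyIntegrableOn hΩ.measurableSet)
    (fun i => (continuousOn_lineDeriv_lineDeriv hΩ hf _).locallyIntegrableOn hΩ.measurableSet)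
    (fun i φ hφ hc hsub => integral_mul_lineDeriv_lineDeriv hΩ hf hφ hc hsub _) ?_
  filter_upwards with x hx
  rw [← laplacian_eq_sum_lineDeriv _ (hf.contDiffAt (hΩ.mem_nhds hx))]
  exact hnonneg x hx

theorem weaklySubharmonicOn_of_hausdorffMeasure_eq_zero {n : ℕ}
    {Ω E : Set (EuclideanSpace ℝ (Fin n))} (hΩ : IsOpen Ω) (hU : IsOpen (Ω \ E))
    (hE : Measure.hausdorffMeasure ((n : ℝ) - 1) E = 0) {u : EuclideanSpace ℝ (Fin n) → ℝ}
    (hu : LocallyIntegrableOn u Ω) (hu2 : ContDiffOn ℝ 2 u (Ω \ E))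
    (hu3 : ∀ j, LocallyIntegrableOn (partialDeriv j (partialDeriv j u)) Ω)
    (hnonneg : ∀ x ∈ Ω \ E, 0 ≤ Δ u x) : WeaklySubharmonicOn u Ω := by
  have hE0 : volume E = 0 := measure_eq_zero_of_hausdorffMeasure_eq_zero (by simp) hE
  refine weaklySubharmonicOn_of_integral_mul_lineDeriv_lineDeriv
    (EuclideanSpace.basisFun (Fin n) ℝ) hu hu3 (fun j φ hφ hc hsub => ?_) ?_
  · rw [EuclideanSpace.basisFun_apply]
    exact integral_mul_partialDeriv_partialDeriv j hΩ hE hu hu2 (hu3 j) hφ hc hsub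
  · filter_upwards [measure_eq_zero_iff_ae_notMem.1 hE0] with x hxE hxΩ
    rw [← laplacian_eq_sum_partialDeriv (hu2.contDiffAt (hU.mem_nhds ⟨hxΩ, hxE⟩))]
    exact hnonneg x ⟨hxΩ, hxE⟩

end WeaklySubharmonic

section RadialLaplacian

variable {V : Type*} [NormedAddCommGroup V] [InnerProductSpace ℝ V]

theorem hasDerivAt_add_smul_sub (x y v : V) : HasDerivAt (fun t : ℝ => y + t • v - x) v 0 := by
  simpa using (((hasDerivAt_id (0 : ℝ)).smul_const v).const_add y).sub_const x

theorem hasLineDerivAt_comp_norm_sub_sq {g : ℝ → ℝ} {x y : V}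
    (hg : DifferentiableAt ℝ g (‖y - x‖ ^ 2)) (v : V) :
    HasLineDerivAt ℝ (fun z => g (‖z - x‖ ^ 2)) (2 * inner ℝ v (y - x) * deriv g (‖y - x‖ ^ 2))
      y v := by
  refine (HasDerivAt.comp_of_eq (0 : ℝ) hg.hasDerivAt (hasDerivAt_add_smul_sub x y v).norm_sq
    (by simp)).congr_deriv ?_
  simp only [zero_smul, add_zero, real_inner_comm v]
  ring

theorem lineDeriv_lineDeriv_comp_norm_sub_sq {g : ℝ → ℝ} (hg : ContDiff ℝ 2 g) (x y v : V) :
    lineDeriv ℝ (fun z => lineDeriv ℝ (fun w => g (‖w - x‖ ^ 2)) z v) y v =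
      4 * inner ℝ v (y - x) ^ 2 * deriv (deriv g) (‖y - x‖ ^ 2) +
        2 * ‖v‖ ^ 2 * deriv g (‖y - x‖ ^ 2) := by
  have hg' : Differentiable ℝ (deriv g) := (hg.iterate_deriv' 1 1).differentiable (by simp)
  have hinner : HasLineDerivAt ℝ (fun z => 2 * inner ℝ v (z - x)) (2 * ‖v‖ ^ 2) y v := by
    simpa [HasLineDerivAt] using
      ((hasDerivAt_const (0 : ℝ) v).inner ℝ (hasDerivAt_add_smul_sub x y v)).const_mul 2
  simp only [(hasLineDerivAt_comp_norm_sub_sq (hg.differentiable (by simp) _) v).lineDeriv]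
  refine (HasDerivAt.mul hinner (hasLineDerivAt_comp_norm_sub_sq (hg' _) v)).deriv.trans ?_
  simp only [zero_smul, add_zero]
  ring

variable [FiniteDimensional ℝ V]

theorem laplacian_comp_norm_sub_sq {g : ℝ → ℝ} (hg : ContDiff ℝ 2 g) (x y : V) :
    Δ (fun z => g (‖z - x‖ ^ 2)) y = 4 * ‖y - x‖ ^ 2 * deriv (deriv g) (‖y - x‖ ^ 2) +
      2 * Module.finrank ℝ V * deriv g (‖y - x‖ ^ 2) := by
  have hcomp : ContDiff ℝ 2 fun z => g (‖z - x‖ ^ 2) :=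
    hg.comp ((contDiff_id.sub contDiff_const).norm_sq ℝ)
  let b := stdOrthonormalBasis ℝ V
  simp only [laplacian_eq_sum_lineDeriv b hcomp.contDiffAt,
    lineDeriv_lineDeriv_comp_norm_sub_sq hg, b.norm_eq_one, Finset.sum_add_distrib,
    ← Finset.sum_mul, ← Finset.mul_sum, b.sum_sq_inner_right]
  simp [mul_comm]

end RadialLaplacian

theorem hasDerivAt_setIntegral_mul {X : Type*} [TopologicalSpace X] [T2Space X]
    [MeasurableSpace X] [OpensMeasurableSpace X] {μ : Measure X} {A : Set X}
    (hA : IsCompact A) {f : X → ℝ} (hf : IntegrableOn f A μ) {U : Set ℝ} (hU : IsOpen U)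
    {K K' : ℝ → X → ℝ} (hK : ∀ t ∈ U, ContinuousOn (K t) A)
    (hK' : ContinuousOn (fun p : ℝ × X => K' p.1 p.2) (U ×ˢ A))
    (hderiv : ∀ t ∈ U, ∀ y ∈ A, HasDerivAt (fun s => K s y) (K' t y) t) {t : ℝ} (ht : t ∈ U) :
    HasDerivAt (fun s => ∫ y in A, f y * K s y ∂μ) (∫ y in A, f y * K' t y ∂μ) t := by
  obtain ⟨ε, hε, hεU⟩ := nhds_basis_closedBall.mem_iff.1 (hU.mem_nhds ht)
  obtain ⟨C, hC⟩ := ((isCompact_closedBall t ε).prod hA).exists_bound_of_continuousOn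
    (hK'.mono (prod_mono_left hεU))
  have hK't : ContinuousOn (K' t) A :=
    hK'.comp (f := fun y => (t, y)) (by fun_prop) fun y hy => ⟨ht, hy⟩
  refine (hasDerivAt_integral_of_dominated_loc_of_deriv_le
    (F := fun s y => f y * K s y) (F' := fun s y => f y * K' s y) (bound := fun y => ‖f y‖ * C)
    (closedBall_mem_nhds t hε) ?_ (hf.mul_continuousOn (hK t ht) hA)
    (hf.mul_continuousOn hK't hA).aestronglyMeasurable ?_ (hf.norm.mul_const C) ?_).2
  · filter_upwards [hU.mem_nhds ht] with s hs
    exact (hf.mul_continuousOn (hK s hs) hA).aestronglyMeasurable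
  · filter_upwards [ae_restrict_mem hA.measurableSet] with y hy s hs
    rw [norm_mul]
    exact mul_le_mul_of_nonneg_left (hC (s, y) ⟨hs, hy⟩) (norm_nonneg _)
  · filter_upwards [ae_restrict_mem hA.measurableSet] with y hy s hs
    exact (hderiv s (hεU hs) y hy).const_mul (f y)

section RadialTail

variable {η : ℝ → ℝ}

/-- The primitive `s ↦ ∫_s^1 η` of `-η`. For `η ≥ 0` vanishing on `[1, ∞)`, the functions
`y ↦ radialTail η (‖y - x‖² / t²)` are test functions supported in the closed ball of radius `t`. -/
noncomputable def radialTail (η : ℝ → ℝ) (s : ℝ) : ℝ := ∫ a in s..1, η a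

theorem hasDerivAt_radialTail (hη : Continuous η) (s : ℝ) : HasDerivAt (radialTail η) (-η s) s :=
  intervalIntegral.integral_hasDerivAt_left (hη.intervalIntegrable _ _)
    hη.stronglyMeasurable.stronglyMeasurableAtFilter hη.continuousAt

theorem contDiff_two_radialTail (hη : ContDiff ℝ 1 η) : ContDiff ℝ 2 (radialTail η) := by
  have hderiv : deriv (radialTail η) = fun s => -η s :=
    funext fun s => (hasDerivAt_radialTail hη.continuous s).deriv
  rw [← one_add_one_eq_two, contDiff_succ_iff_deriv, hderiv]
  exact ⟨fun s => (hasDerivAt_radialTail hη.continuous s).differentiableAt, by simp, hη.neg⟩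

theorem radialTail_eq_zero (hη1 : ∀ s, 1 ≤ s → η s = 0) {s : ℝ} (hs : 1 ≤ s) :
    radialTail η s = 0 := by
  have hzero : EqOn η 0 (uIcc s 1) := fun a ha => hη1 a (uIcc_of_ge hs ▸ ha).1
  simp [radialTail, intervalIntegral.integral_congr hzero]

theorem radialTail_nonneg (hη0 : ∀ s, 0 ≤ η s) (hη1 : ∀ s, 1 ≤ s → η s = 0) (s : ℝ) :
    0 ≤ radialTail η s := by
  rcases le_total s 1 with hs | hs
  · exact intervalIntegral.integral_nonneg hs fun a _ => hη0 a
  · exact (radialTail_eq_zero hη1 hs).ge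

variable {V : Type*} [NormedAddCommGroup V]

theorem one_le_norm_sub_sq_div_sq {x y : V} {t : ℝ}
    (ht : 0 < t) (hy : y ∉ ball x t) : 1 ≤ ‖y - x‖ ^ 2 / t ^ 2 := by
  rw [mem_ball, dist_eq_norm, not_lt] at hy
  rw [one_le_div (by positivity)]
  exact pow_le_pow_left₀ ht.le hy 2

theorem tsupport_radialTail_subset (hη1 : ∀ s, 1 ≤ s → η s = 0) (x : V) {t : ℝ} (ht : 0 < t) :
    tsupport (fun y => radialTail η (‖y - x‖ ^ 2 / t ^ 2)) ⊆ closedBall x t := by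
  refine closure_minimal (fun y hy => ?_) isClosed_closedBall
  by_contra h
  exact hy (radialTail_eq_zero hη1 (one_le_norm_sub_sq_div_sq ht fun h' =>
    h (ball_subset_closedBall h')))

theorem laplacian_radialTail [InnerProductSpace ℝ V] [FiniteDimensional ℝ V]
    (hη : ContDiff ℝ 1 η) (x y : V) (t : ℝ) :
    Δ (fun z => radialTail η (‖z - x‖ ^ 2 / t ^ 2)) y =
      -(2 / t ^ 2) * (Module.finrank ℝ V * η (‖y - x‖ ^ 2 / t ^ 2) +
        2 * (‖y - x‖ ^ 2 / t ^ 2) * deriv η (‖y - x‖ ^ 2 / t ^ 2)) := by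
  have hdiv (s : ℝ) : HasDerivAt (fun s => s / t ^ 2) (1 / t ^ 2) s :=
    (hasDerivAt_id s).div_const _
  have hderiv : deriv (fun s => radialTail η (s / t ^ 2)) = fun s => -η (s / t ^ 2) * (1 / t ^ 2) :=
    funext fun s => ((hasDerivAt_radialTail hη.continuous _).comp s (hdiv s)).deriv
  have hderiv2 (s : ℝ) : deriv (fun s => -η (s / t ^ 2) * (1 / t ^ 2)) s =
      -(deriv η (s / t ^ 2) * (1 / t ^ 2)) * (1 / t ^ 2) :=
    ((((hη.differentiable (by simp) _).hasDerivAt.comp s (hdiv s)).neg).mul_const _).deriv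
  have hcomp : ContDiff ℝ 2 fun s => radialTail η (s / t ^ 2) :=
    (contDiff_two_radialTail hη).comp (contDiff_id.div_const _)
  rw [laplacian_comp_norm_sub_sq hcomp, hderiv, hderiv2]
  ring

end RadialTail

section RadialKernel

variable {V : Type*} [NormedAddCommGroup V] [InnerProductSpace ℝ V] {η : ℝ → ℝ}

/-- The kernel `t⁻ᵈ η(‖y - x‖² / t²)` on a `d`-dimensional space, a smoothed version of the
normalised indicator function of the ball of radius `t` centred at `x`. -/
noncomputable def radialKernel (η : ℝ → ℝ) (x : V) (t : ℝ) (y : V) : ℝ :=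
  (t ^ Module.finrank ℝ V)⁻¹ * η (‖y - x‖ ^ 2 / t ^ 2)

/-- The derivative of `radialKernel η x t y` with respect to `t`. -/
noncomputable def radialKernelDeriv (η : ℝ → ℝ) (x : V) (t : ℝ) (y : V) : ℝ :=
  -(t ^ (Module.finrank ℝ V + 1))⁻¹ * (Module.finrank ℝ V * η (‖y - x‖ ^ 2 / t ^ 2) +
    2 * (‖y - x‖ ^ 2 / t ^ 2) * deriv η (‖y - x‖ ^ 2 / t ^ 2))

theorem continuous_radialKernel (hη : Continuous η) (x : V) (t : ℝ) :
    Continuous (radialKernel η x t) := by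
  unfold radialKernel
  fun_prop

theorem continuousOn_radialKernelDeriv (hη : ContDiff ℝ 1 η) (x : V) :
    ContinuousOn (fun p : ℝ × V => radialKernelDeriv η x p.1 p.2) (Ioi 0 ×ˢ univ) := by
  have hη' : Continuous (deriv η) := hη.continuous_deriv le_rfl
  have hpow (k : ℕ) : ∀ p ∈ Ioi (0 : ℝ) ×ˢ (univ : Set V), p.1 ^ k ≠ 0 :=
    fun p hp => pow_ne_zero k hp.1.ne'
  have hρ : ContinuousOn (fun p : ℝ × V => ‖p.2 - x‖ ^ 2 / p.1 ^ 2) (Ioi 0 ×ˢ univ) :=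
    ContinuousOn.div (by fun_prop) (by fun_prop) (hpow 2)
  have hinv : ContinuousOn (fun p : ℝ × V => -(p.1 ^ (Module.finrank ℝ V + 1))⁻¹)
      (Ioi 0 ×ˢ univ) :=
    (ContinuousOn.inv₀ (by fun_prop) (hpow _)).neg
  exact hinv.mul ((continuousOn_const.mul (hη.continuous.comp_continuousOn hρ)).add
    ((continuousOn_const.mul hρ).mul (hη'.comp_continuousOn hρ)))

theorem hasDerivAt_radialKernel (hη : Differentiable ℝ η) (x y : V) {t : ℝ} (ht : t ≠ 0) :
    HasDerivAt (fun t => radialKernel η x t y) (radialKernelDeriv η x t y) t := by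
  have hpow : HasDerivAt (fun t : ℝ => (t ^ Module.finrank ℝ V)⁻¹)
      (-(Module.finrank ℝ V * (t ^ (Module.finrank ℝ V + 1))⁻¹)) t := by
    simp only [← zpow_natCast, ← zpow_neg]
    refine (hasDerivAt_zpow _ t (Or.inl ht)).congr_deriv ?_
    push_cast
    rw [neg_add', neg_mul]
  have hρ : HasDerivAt (fun t : ℝ => ‖y - x‖ ^ 2 / t ^ 2) (-(2 * (‖y - x‖ ^ 2 / t ^ 2) / t)) t := by
    refine ((hasDerivAt_const t (‖y - x‖ ^ 2)).fun_div (hasDerivAt_pow 2 t)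
      (pow_ne_zero 2 ht)).congr_deriv ?_
    field_simp
    push_cast
    ring
  refine (hpow.mul ((hη _).hasDerivAt.comp t hρ)).congr_deriv ?_
  simp only [radialKernelDeriv, Function.comp]
  field_simp
  ring

theorem radialKernelDeriv_eq_laplacian [FiniteDimensional ℝ V] (hη : ContDiff ℝ 1 η) (x y : V)
    {t : ℝ} (ht : t ≠ 0) :
    radialKernelDeriv η x t y = t / 2 * (t ^ Module.finrank ℝ V)⁻¹ *
      Δ (fun z => radialTail η (‖z - x‖ ^ 2 / t ^ 2)) y := by
  rw [laplacian_radialTail hη, radialKernelDeriv]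
  field_simp
  ring

end RadialKernel

section Monotonicity

variable {V : Type*} [NormedAddCommGroup V] [InnerProductSpace ℝ V] [FiniteDimensional ℝ V]
  [MeasurableSpace V] [BorelSpace V] {f : V → ℝ} {Ω : Set V} {x : V} {η : ℝ → ℝ}

theorem WeaklySubharmonicOn.setIntegral_mul_radialKernelDeriv_nonneg
    (hf : WeaklySubharmonicOn f Ω) {t R : ℝ} (ht : 0 < t) (htR : t ≤ R)
    (hR : closedBall x R ⊆ Ω) (hη : ContDiff ℝ 1 η) (hη0 : ∀ s, 0 ≤ η s)
    (hη1 : ∀ s, 1 ≤ s → η s = 0) :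
    0 ≤ ∫ y in closedBall x R, f y * radialKernelDeriv η x t y := by
  let ψ : V → ℝ := fun y => radialTail η (‖y - x‖ ^ 2 / t ^ 2)
  have hψ : ContDiff ℝ 2 ψ :=
    (contDiff_two_radialTail hη).comp (((contDiff_id.sub contDiff_const).norm_sq ℝ).div_const _)
  have hψt : tsupport ψ ⊆ closedBall x t := tsupport_radialTail_subset hη1 x ht
  have hψR : tsupport ψ ⊆ closedBall x R := hψt.trans (closedBall_subset_closedBall htR)
  have hψΔ : 0 ≤ ∫ y, f y * Δ ψ y :=
    hf ψ hψ ((isCompact_closedBall x t).of_isClosed_subset (isClosed_tsupport _) hψt)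
      (hψR.trans hR) fun y => radialTail_nonneg hη0 hη1 _
  simp only [radialKernelDeriv_eq_laplacian hη x _ ht.ne', mul_left_comm (f _),
    integral_const_mul]
  rw [setIntegral_eq_integral_of_forall_compl_eq_zero]
  · positivity
  · intro y hy
    rw [image_eq_zero_of_notMem_tsupport fun h => hy (hψR (tsupport_laplacian_subset ψ h)),
      mul_zero]

theorem WeaklySubharmonicOn.monotoneOn_setIntegral_mul_radialKernel
    (hf : WeaklySubharmonicOn f Ω) {R : ℝ} (hR : closedBall x R ⊆ Ω)
    (hi : IntegrableOn f (closedBall x R)) (hη : ContDiff ℝ 1 η) (hη0 : ∀ s, 0 ≤ η s)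
    (hη1 : ∀ s, 1 ≤ s → η s = 0) :
    MonotoneOn (fun t => ∫ y in closedBall x R, f y * radialKernel η x t y) (Ioc 0 R) := by
  have hderiv : ∀ t ∈ Ioi (0 : ℝ), HasDerivAt
      (fun t => ∫ y in closedBall x R, f y * radialKernel η x t y)
      (∫ y in closedBall x R, f y * radialKernelDeriv η x t y) t := fun t =>
    hasDerivAt_setIntegral_mul (isCompact_closedBall x R) hi isOpen_Ioi
      (fun t _ => (continuous_radialKernel hη.continuous x t).continuousOn)
      ((continuousOn_radialKernelDeriv hη x).mono (prod_mono_right (subset_univ _)))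
      (fun t ht y _ => hasDerivAt_radialKernel (hη.differentiable (by simp)) x y ht.ne')
  refine monotoneOn_of_deriv_nonneg (convex_Ioc 0 R)
    (fun t ht => (hderiv t ht.1).continuousAt.continuousWithinAt) ?_ ?_
  · exact fun t ht => (hderiv t (interior_subset ht).1).differentiableAt.differentiableWithinAt
  · intro t ht
    obtain ⟨ht0, htR⟩ := interior_subset ht
    rw [(hderiv t ht0).deriv]
    exact hf.setIntegral_mul_radialKernelDeriv_nonneg ht0 htR hR hη hη0 hη1

end Monotonicity

section SetAverage

variable {V : Type*} [NormedAddCommGroup V] [NormedSpace ℝ V] [FiniteDimensional ℝ V]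
  [MeasurableSpace V] [BorelSpace V] {μ : Measure V} [μ.IsAddHaarMeasure] {f : V → ℝ} {x : V}

theorem setAverage_closedBall_eq (f : V → ℝ) (x : V) {r : ℝ} (hr : 0 < r) :
    ⨍ y in closedBall x r, f y ∂μ =
      (μ.real (ball 0 1))⁻¹ * ((r ^ Module.finrank ℝ V)⁻¹ * ∫ y in ball x r, f y ∂μ) := by
  have hsphere : μ (closedBall x r \ ball x r) = 0 := by
    rw [closedBall_sdiff_ball, Measure.addHaar_sphere_of_ne_zero μ x hr.ne']
  have hball : closedBall x r =ᵐ[μ] ball x r :=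
    (ball_subset_closedBall.eventuallyLE.antisymm (ae_le_set.2 hsphere)).symm
  rw [setAverage_eq, smul_eq_mul, Measure.addHaar_real_closedBall μ x hr.le,
    setIntegral_congr_set hball, mul_inv, mul_comm _⁻¹, mul_assoc]

end SetAverage

theorem tendsto_smoothTransition_natCast_mul (a : ℝ) :
    Tendsto (fun k : ℕ => Real.smoothTransition (k * a)) atTop (𝓝 ((Ioi 0).indicator 1 a)) := by
  by_cases ha : a ∈ Ioi (0 : ℝ)
  · rw [indicator_of_mem ha]
    refine tendsto_const_nhds.congr' ?_
    have hk : Tendsto (fun k : ℕ => (k : ℝ) * a) atTop atTop :=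
      tendsto_natCast_atTop_atTop.atTop_mul_const ha
    filter_upwards [hk.eventually_ge_atTop 1] with k hk
    exact (Real.smoothTransition.one_of_one_le hk).symm
  · rw [indicator_of_notMem ha]
    refine tendsto_const_nhds.congr fun k => ?_
    exact (Real.smoothTransition.zero_of_nonpos
      (mul_nonpos_of_nonneg_of_nonpos (Nat.cast_nonneg k) (not_lt.1 ha))).symm

section MeanValue

variable {V : Type*} [NormedAddCommGroup V] [InnerProductSpace ℝ V]

theorem tendsto_radialKernel_smoothTransition (x y : V) {t : ℝ} (ht : 0 < t) :
    Tendsto (fun k : ℕ => radialKernel (fun s => Real.smoothTransition (k * (1 - s))) x t y) atTop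
      (𝓝 ((ball x t).indicator (fun _ => (t ^ Module.finrank ℝ V)⁻¹) y)) := by
  have hball : 0 < 1 - ‖y - x‖ ^ 2 / t ^ 2 ↔ y ∈ ball x t := by
    rw [sub_pos, div_lt_one (by positivity), sq_lt_sq₀ (norm_nonneg _) ht.le, mem_ball_iff_norm]
  convert (tendsto_smoothTransition_natCast_mul (1 - ‖y - x‖ ^ 2 / t ^ 2)).const_mul
    (t ^ Module.finrank ℝ V)⁻¹ using 2
  · rfl
  · by_cases hy : y ∈ ball x t <;> simp [-mem_ball, hball, hy, indicator]

variable [FiniteDimensional ℝ V] [MeasurableSpace V] [BorelSpace V] {f : V → ℝ} {Ω : Set V} {x : V}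

theorem tendsto_setIntegral_mul_radialKernel_smoothTransition {t R : ℝ} (ht : 0 < t) (htR : t ≤ R)
    (hi : IntegrableOn f (closedBall x R)) :
    Tendsto (fun k : ℕ => ∫ y in closedBall x R,
        f y * radialKernel (fun s => Real.smoothTransition (k * (1 - s))) x t y) atTop
      (𝓝 ((t ^ Module.finrank ℝ V)⁻¹ * ∫ y in ball x t, f y)) := by
  have hlim : (t ^ Module.finrank ℝ V)⁻¹ * ∫ y in ball x t, f y = ∫ y in closedBall x R,
      f y * (ball x t).indicator (fun _ => (t ^ Module.finrank ℝ V)⁻¹) y := by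
    have hind (y : V) : f y * (ball x t).indicator (fun _ => (t ^ Module.finrank ℝ V)⁻¹) y =
        (ball x t).indicator (fun y => (t ^ Module.finrank ℝ V)⁻¹ * f y) y := by
      by_cases hy : y ∈ ball x t <;> simp [-mem_ball, hy, mul_comm]
    simp only [hind]
    rw [setIntegral_indicator isOpen_ball.measurableSet, integral_const_mul,
      inter_eq_right.2 (ball_subset_closedBall.trans (closedBall_subset_closedBall htR))]
  rw [hlim]
  refine tendsto_integral_of_dominated_convergence
    (fun y => ‖f y‖ * (t ^ Module.finrank ℝ V)⁻¹) (fun k => ?_) (hi.norm.mul_const _)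
    (fun k => Eventually.of_forall fun y => ?_) (Eventually.of_forall fun y =>
      (tendsto_radialKernel_smoothTransition x y ht).const_mul (f y))
  · have hη : Continuous fun s : ℝ => Real.smoothTransition (k * (1 - s)) :=
      Real.smoothTransition.continuous.comp (by fun_prop)
    exact hi.aestronglyMeasurable.mul (continuous_radialKernel hη x t).aestronglyMeasurable
  · have hη0 := Real.smoothTransition.nonneg (k * (1 - ‖y - x‖ ^ 2 / t ^ 2))
    rw [norm_mul]
    refine mul_le_mul_of_nonneg_left ?_ (norm_nonneg _)
    rw [radialKernel, Real.norm_of_nonneg (by positivity)]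
    exact mul_le_of_le_one_right (by positivity) (Real.smoothTransition.le_one _)

theorem WeaklySubharmonicOn.setAverage_mono (hf : WeaklySubharmonicOn f Ω)
    (hi : LocallyIntegrableOn f Ω) {s r : ℝ} (hs : 0 < s) (hsr : s ≤ r)
    (hr : closedBall x r ⊆ Ω) :
    ⨍ y in closedBall x s, f y ≤ ⨍ y in closedBall x r, f y := by
  have hr0 : 0 < r := hs.trans_le hsr
  have hir : IntegrableOn f (closedBall x r) :=
    hi.integrableOn_compact_subset hr (isCompact_closedBall x r)
  rw [setAverage_closedBall_eq f x hs, setAverage_closedBall_eq f x hr0]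
  refine mul_le_mul_of_nonneg_left ?_ (by positivity)
  refine le_of_tendsto_of_tendsto'
    (tendsto_setIntegral_mul_radialKernel_smoothTransition hs hsr hir)
    (tendsto_setIntegral_mul_radialKernel_smoothTransition hr0 le_rfl hir) fun k => ?_
  have hη : ContDiff ℝ 1 fun s : ℝ => Real.smoothTransition (k * (1 - s)) :=
    Real.smoothTransition.contDiff.comp (contDiff_const.mul (contDiff_const.sub contDiff_id))
  have hη1 (a : ℝ) (ha : 1 ≤ a) : Real.smoothTransition (k * (1 - a)) = 0 :=
    Real.smoothTransition.zero_of_nonpos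
      (mul_nonpos_of_nonneg_of_nonpos (Nat.cast_nonneg k) (sub_nonpos.2 ha))
  exact hf.monotoneOn_setIntegral_mul_radialKernel hr hir hη
    (fun _ => Real.smoothTransition.nonneg _) hη1 ⟨hs, hsr⟩ ⟨hr0, le_rfl⟩ hsr

theorem WeaklySubharmonicOn.le_setAverage_of_tendsto (hf : WeaklySubharmonicOn f Ω)
    (hi : LocallyIntegrableOn f Ω)
    (hx : Tendsto (fun s => ⨍ y in closedBall x s, f y) (𝓝[>] 0) (𝓝 (f x))) {r : ℝ} (hr : 0 < r)
    (hsub : closedBall x r ⊆ Ω) : f x ≤ ⨍ y in closedBall x r, f y := by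
  refine le_of_tendsto hx ?_
  filter_upwards [Ioc_mem_nhdsGT hr] with s hs
  exact hf.setAverage_mono hi hs.1 hs.2 hsub

end MeanValue

theorem tendsto_setAverage_closedBall {V E : Type*} [PseudoMetricSpace V] [ProperSpace V]
    [MeasurableSpace V] [OpensMeasurableSpace V] {μ : Measure V} [μ.IsOpenPosMeasure]
    [IsFiniteMeasureOnCompacts μ] [NormedAddCommGroup E] [NormedSpace ℝ E] [CompleteSpace E]
    {f : V → E} {x : V} (hi : IntegrableAtFilter f (𝓝 x) μ) (hx : ContinuousAt f x) :
    Tendsto (fun r => ⨍ y in closedBall x r, f y ∂μ) (𝓝[>] 0) (𝓝 (f x)) := by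
  refine nhds_basis_closedBall.tendsto_right_iff.2 fun ε hε => ?_
  obtain ⟨A, hA, hfA⟩ := hi
  obtain ⟨δ, hδ, hsub⟩ := nhds_basis_closedBall.mem_iff.1
    (inter_mem hA (hx.preimage_mem_nhds (closedBall_mem_nhds (f x) hε)))
  filter_upwards [Ioc_mem_nhdsGT hδ] with r hr
  have hrsub : closedBall x r ⊆ A ∩ f ⁻¹' closedBall (f x) ε :=
    (closedBall_subset_closedBall hr.2).trans hsub
  exact (convex_closedBall (f x) ε).set_average_mem isClosed_closedBall
    (measure_closedBall_pos μ x hr.1).ne' measure_closedBall_lt_top.ne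
    (ae_restrict_of_forall_mem measurableSet_closedBall fun y hy => (hrsub hy).2)
    (hfA.mono_set fun y hy => (hrsub hy).1)

theorem setAverage_norm_sub_sq_pos {V : Type*} [NormedAddCommGroup V] [ProperSpace V]
    [MeasurableSpace V] [OpensMeasurableSpace V] {μ : Measure V} [μ.IsOpenPosMeasure]
    [IsFiniteMeasureOnCompacts μ] [NullSingletonClass μ] (x : V) {r : ℝ} (hr : 0 < r) :
    0 < ⨍ y in closedBall x r, ‖y - x‖ ^ 2 ∂μ := by
  have hi : IntegrableOn (fun y => ‖y - x‖ ^ 2) (closedBall x r) μ :=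
    ContinuousOn.integrableOn_compact (isCompact_closedBall x r) (by fun_prop)
  have hsupp : closedBall x r \ {x} ⊆
      Function.support (fun y => ‖y - x‖ ^ 2) ∩ closedBall x r := by
    rintro y ⟨hy, hyx⟩
    exact ⟨pow_ne_zero 2 (norm_ne_zero_iff.2 (sub_ne_zero.2 hyx)), hy⟩
  have hint : 0 < ∫ y in closedBall x r, ‖y - x‖ ^ 2 ∂μ := by
    rw [setIntegral_pos_iff_support_of_nonneg_ae (ae_of_all _ fun y => by positivity) hi]
    refine lt_of_lt_of_le ?_ (measure_mono hsupp)
    rw [measure_sdiff_null (measure_singleton x)]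
    exact measure_closedBall_pos μ x hr
  have hvol : 0 < μ.real (closedBall x r) :=
    ENNReal.toReal_pos (measure_closedBall_pos μ x hr).ne' measure_closedBall_lt_top.ne
  rw [setAverage_eq, smul_eq_mul]
  exact mul_pos (inv_pos.2 hvol) hint

section ClassicalLaplacian

variable {V : Type*} [NormedAddCommGroup V] [InnerProductSpace ℝ V] [FiniteDimensional ℝ V]

theorem laplacian_const_mul_norm_sub_sq (c : ℝ) (x y : V) :
    Δ (fun z => c * ‖z - x‖ ^ 2) y = 2 * Module.finrank ℝ V * c := by
  have hderiv : deriv (fun s => c * s) = fun _ => c := by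
    ext s
    simp
  rw [laplacian_comp_norm_sub_sq (g := fun s => c * s) (by fun_prop), hderiv]
  simp

theorem nontrivial_of_laplacian_ne_zero {f : V → ℝ} {x : V} (h : Δ f x ≠ 0) : Nontrivial V := by
  contrapose! h
  have hrank : Module.finrank ℝ V = 0 := Module.finrank_zero_of_subsingleton
  have hempty : IsEmpty (Fin (Module.finrank ℝ V)) := hrank ▸ Fin.isEmpty'
  simp [laplacian_eq_iteratedFDeriv_stdOrthonormalBasis]

variable [MeasurableSpace V] [BorelSpace V] {f : V → ℝ} {x : V}

theorem eventually_lt_setAverage_of_laplacian_pos (hf : ContDiffAt ℝ 2 f x) (hpos : 0 < Δ f x) :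
    ∀ᶠ r in 𝓝[>] 0, f x < ⨍ y in closedBall x r, f y := by
  have : Nontrivial V := nontrivial_of_laplacian_ne_zero hpos.ne'
  obtain ⟨c, hc, hcΔ⟩ : ∃ c, 0 < c ∧ 2 * Module.finrank ℝ V * c < Δ f x := by
    refine ⟨Δ f x / (2 * Module.finrank ℝ V + 1), by positivity, ?_⟩
    rw [mul_div_assoc', div_lt_iff₀ (by positivity)]
    linarith
  -- Subtracting `c * ‖y - x‖ ^ 2` keeps the Laplacian positive near `x` and makes the mean value
  -- inequality strict.
  let q : V → ℝ := fun y => c * ‖y - x‖ ^ 2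
  have hq : ContDiff ℝ 2 q := contDiff_const.mul ((contDiff_id.sub contDiff_const).norm_sq ℝ)
  obtain ⟨R, hR, hB⟩ := nhds_basis_ball.eventually_iff.1
    ((hf.eventually (by simp)).and ((continuousAt_laplacian hf).eventually_const_lt hcΔ))
  have hfB : ContDiffOn ℝ 2 f (ball x R) := fun y hy => (hB hy).1.contDiffWithinAt
  have hwB : ContDiffOn ℝ 2 (f - q) (ball x R) := hfB.sub hq.contDiffOn
  have hw : WeaklySubharmonicOn (f - q) (ball x R) := by
    refine weaklySubharmonicOn_of_laplacian_nonneg isOpen_ball hwB fun y hy => ?_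
    rw [(hB hy).1.laplacian_sub hq.contDiffAt, laplacian_const_mul_norm_sub_sq]
    exact sub_nonneg.2 (hB hy).2.le
  have hwi : LocallyIntegrableOn (f - q) (ball x R) :=
    hwB.continuousOn.locallyIntegrableOn measurableSet_ball
  have hwix : IntegrableAtFilter (f - q) (𝓝 x) := by
    simpa only [isOpen_ball.nhdsWithin_eq (mem_ball_self hR)] using hwi x (mem_ball_self hR)
  have hwx : ContinuousAt (f - q) x := hf.continuousAt.sub hq.continuous.continuousAt
  filter_upwards [Ioo_mem_nhdsGT hR] with r hr
  have hrB : closedBall x r ⊆ ball x R := closedBall_subset_ball hr.2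
  have hcpt : IsCompact (closedBall x r) := isCompact_closedBall x r
  calc f x = (f - q) x := by simp [q]
    _ ≤ ⨍ y in closedBall x r, (f - q) y := hw.le_setAverage_of_tendsto hwi
        (tendsto_setAverage_closedBall hwix hwx) hr.1 hrB
    _ = (⨍ y in closedBall x r, f y) - c * ⨍ y in closedBall x r, ‖y - x‖ ^ 2 := by
        simp only [setAverage_eq, smul_eq_mul]
        rw [integral_sub' ((hfB.continuousOn.mono hrB).integrableOn_compact hcpt)
          (hq.continuous.continuousOn.integrableOn_compact hcpt), integral_const_mul]
        ring
    _ < ⨍ y in closedBall x r, f y :=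
        sub_lt_self _ (mul_pos hc (setAverage_norm_sub_sq_pos x hr.1))

theorem laplacian_nonneg_of_frequently_le_setAverage (hf : ContDiffAt ℝ 2 f x)
    (hle : ∃ᶠ r in 𝓝[>] 0, f x ≤ ⨍ y in closedBall x r, f y) : 0 ≤ Δ f x := by
  by_contra! hneg
  have hpos : 0 < Δ (-f) x := by simpa [laplacian_neg] using hneg
  refine hle ?_
  filter_upwards [eventually_lt_setAverage_of_laplacian_pos hf.neg hpos] with r hr
  simpa [setAverage_eq, integral_neg] using hr

end ClassicalLaplacian

theorem exists_lt_closedBall_subset {V : Type*} [NormedAddCommGroup V] [NormedSpace ℝ V]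
    [ProperSpace V] {Ω : Set V} {x : V} {r : ℝ} (hΩ : IsOpen Ω) (hr : 0 ≤ r)
    (hsub : closedBall x r ⊆ Ω) : ∃ R, r < R ∧ closedBall x R ⊆ Ω := by
  obtain ⟨δ, hδ, hthick⟩ := (isCompact_closedBall x r).exists_cthickening_subset_open hΩ hsub
  refine ⟨δ + r, by linarith, ?_⟩
  rwa [cthickening_closedBall hδ.le hr] at hthick

section InfBallAverage

variable {V : Type*} [PseudoMetricSpace V] [MeasurableSpace V] {μ : Measure V} {f : V → ℝ}
  {Ω : Set V} {x : V}

/-- The infimum of the averages of `f` over the closed balls with centre `x` contained in `Ω`. For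
weakly subharmonic `f` these averages decrease with the radius, so this is their limit at `0`; it is
the subharmonic representative of `f`. -/
noncomputable def infBallAverage (μ : Measure V) (f : V → ℝ) (Ω : Set V) (x : V) : EReal :=
  ⨅ (r : ℝ) (_ : 0 < r ∧ closedBall x r ⊆ Ω), ((⨍ y in closedBall x r, f y ∂μ : ℝ) : EReal)

theorem infBallAverage_le {r : ℝ} (hr : 0 < r) (hsub : closedBall x r ⊆ Ω) :
    infBallAverage μ f Ω x ≤ ((⨍ y in closedBall x r, f y ∂μ : ℝ) : EReal) :=
  iInf₂_le r ⟨hr, hsub⟩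

theorem infBallAverage_lt_top (hΩ : IsOpen Ω) (hx : x ∈ Ω) : infBallAverage μ f Ω x < ⊤ := by
  obtain ⟨r, hr, hsub⟩ := nhds_basis_closedBall.mem_iff.1 (hΩ.mem_nhds hx)
  exact (infBallAverage_le hr hsub).trans_lt (EReal.coe_lt_top _)

end InfBallAverage

section Regularity

variable {V : Type*} [NormedAddCommGroup V] [NormedSpace ℝ V] [FiniteDimensional ℝ V]
  [MeasurableSpace V] [BorelSpace V] {μ : Measure V} [μ.IsAddHaarMeasure] {f : V → ℝ} {Ω : Set V}
  {x : V}

theorem ae_tendsto_setAverage_closedBall (hΩ : IsOpen Ω) (hi : LocallyIntegrableOn f Ω μ) :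
    ∀ᵐ x ∂μ, x ∈ Ω → Tendsto (fun r => ⨍ y in closedBall x r, f y ∂μ) (𝓝[>] 0) (𝓝 (f x)) := by
  obtain ⟨u, hu, hΩu, hiu⟩ := hi.exists_nat_integrableOn
  have huΩ (k : ℕ) : IsOpen (u k ∩ Ω) := (hu k).inter hΩ
  have hlim (k : ℕ) : ∀ᵐ x ∂μ, Tendsto
      (fun r => ⨍ y in closedBall x r, (u k ∩ Ω).indicator f y ∂μ) (𝓝[>] 0)
      (𝓝 ((u k ∩ Ω).indicator f x)) := by
    have hik : LocallyIntegrable ((u k ∩ Ω).indicator f) μ :=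
      ((hiu k).integrable_indicator (huΩ k).measurableSet).locallyIntegrable
    filter_upwards [IsUnifLocDoublingMeasure.ae_tendsto_average μ hik 1] with x hx
    refine hx (fun _ => x) id tendsto_id ?_
    filter_upwards [self_mem_nhdsWithin] with r hr
    exact mem_closedBall_self (by simpa using (mem_Ioi.1 hr).le)
  filter_upwards [ae_all_iff.2 hlim] with x hx hxΩ
  obtain ⟨k, hk⟩ := mem_iUnion.1 (hΩu hxΩ)
  have hxk : x ∈ u k ∩ Ω := ⟨hk, hxΩ⟩
  obtain ⟨δ, hδ, hsub⟩ := nhds_basis_closedBall.mem_iff.1 ((huΩ k).mem_nhds hxk)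
  rw [← indicator_of_mem hxk f]
  refine (hx k).congr' ?_
  filter_upwards [Ioc_mem_nhdsGT hδ] with r hr
  exact setAverage_congr_fun measurableSet_closedBall (ae_of_all _ fun y hy =>
    indicator_of_mem (hsub (closedBall_subset_closedBall hr.2 hy)) f)

theorem continuousAt_setAverage_closedBall {r R : ℝ} (hr : 0 < r) (hrR : r < R)
    (hi : IntegrableOn f (closedBall x R) μ) :
    ContinuousAt (fun z => ⨍ y in closedBall z r, f y ∂μ) x := by
  have hind : ContinuousAt (fun z => ∫ y in closedBall x R, (ball z r).indicator f y ∂μ) x := by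
    refine continuousAt_of_dominated (bound := fun y => ‖f y‖)
      (Eventually.of_forall fun z =>
        hi.aestronglyMeasurable.indicator isOpen_ball.measurableSet)
      (Eventually.of_forall fun z => ae_of_all _ fun y => norm_indicator_le_norm_self f y)
      hi.norm (ae_restrict_of_ae ?_)
    filter_upwards [measure_eq_zero_iff_ae_notMem.1
      (Measure.addHaar_sphere_of_ne_zero μ x hr.ne')] with y hy
    have hdist : ContinuousAt (fun z => dist y z) x := by fun_prop
    rcases lt_or_gt_of_ne hy with hlt | hgt
    · refine (continuousAt_const (y := f y)).congr ?_
      filter_upwards [hdist.eventually_lt_const hlt] with z hz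
      exact (indicator_of_mem (mem_ball.2 hz) f).symm
    · refine (continuousAt_const (y := (0 : ℝ))).congr ?_
      filter_upwards [hdist.eventually_const_lt hgt] with z hz
      exact (indicator_of_notMem (fun h => lt_asymm hz (mem_ball.1 h)) f).symm
  simp only [setAverage_closedBall_eq f _ hr]
  refine continuousAt_const.mul (continuousAt_const.mul (hind.congr ?_))
  filter_upwards [ball_mem_nhds x (sub_pos.2 hrR)] with z hz
  have hzR : closedBall z r ⊆ closedBall x R :=
    closedBall_subset_closedBall' (by linarith [mem_ball.1 hz])
  rw [setIntegral_indicator isOpen_ball.measurableSet,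
    inter_eq_right.2 (ball_subset_closedBall.trans hzR)]

theorem upperSemicontinuousOn_infBallAverage (hΩ : IsOpen Ω) (hi : LocallyIntegrableOn f Ω μ) :
    UpperSemicontinuousOn (infBallAverage μ f Ω) Ω := by
  intro x _ c hc
  obtain ⟨r, ⟨hr, hsub⟩, hrc⟩ : ∃ r, ∃ _ : 0 < r ∧ closedBall x r ⊆ Ω,
      ((⨍ y in closedBall x r, f y ∂μ : ℝ) : EReal) < c := by
    simpa only [infBallAverage, iInf_lt_iff] using hc
  obtain ⟨R, hrR, hR⟩ := exists_lt_closedBall_subset hΩ hr.le hsub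
  have hcont : ContinuousAt (fun z => ((⨍ y in closedBall z r, f y ∂μ : ℝ) : EReal)) x :=
    continuous_coe_real_ereal.continuousAt.comp (continuousAt_setAverage_closedBall hr hrR
      (hi.integrableOn_compact_subset hR (isCompact_closedBall x R)))
  refine mem_nhdsWithin_of_mem_nhds ?_
  filter_upwards [hcont.eventually_lt_const hrc, ball_mem_nhds x (sub_pos.2 hrR)] with z hz hzR
  have hzsub : closedBall z r ⊆ closedBall x R :=
    closedBall_subset_closedBall' (by linarith [mem_ball.1 hzR])
  exact (infBallAverage_le hr (hzsub.trans hR)).trans_lt hz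

end Regularity

section Representative

variable {V : Type*} [NormedAddCommGroup V] [InnerProductSpace ℝ V] [FiniteDimensional ℝ V]
  [MeasurableSpace V] [BorelSpace V] {f : V → ℝ} {Ω : Set V} {x : V}

theorem WeaklySubharmonicOn.infBallAverage_eq_of_tendsto (hf : WeaklySubharmonicOn f Ω)
    (hΩ : IsOpen Ω) (hi : LocallyIntegrableOn f Ω) (hx : x ∈ Ω)
    (hlim : Tendsto (fun r => ⨍ y in closedBall x r, f y) (𝓝[>] 0) (𝓝 (f x))) :
    infBallAverage volume f Ω x = f x := by
  refine le_antisymm ?_ (le_iInf₂ fun r hr => EReal.coe_le_coe_iff.2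
    (hf.le_setAverage_of_tendsto hi hlim hr.1 hr.2))
  refine ge_of_tendsto (continuous_coe_real_ereal.continuousAt.tendsto.comp hlim) ?_
  obtain ⟨δ, hδ, hsub⟩ := nhds_basis_closedBall.mem_iff.1 (hΩ.mem_nhds hx)
  filter_upwards [Ioc_mem_nhdsGT hδ] with r hr
  exact infBallAverage_le hr.1 ((closedBall_subset_closedBall hr.2).trans hsub)

theorem WeaklySubharmonicOn.ae_infBallAverage_eq (hf : WeaklySubharmonicOn f Ω) (hΩ : IsOpen Ω)
    (hi : LocallyIntegrableOn f Ω) : ∀ᵐ x, x ∈ Ω → infBallAverage volume f Ω x = f x := by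
  filter_upwards [ae_tendsto_setAverage_closedBall hΩ hi] with x hlim hx
  exact hf.infBallAverage_eq_of_tendsto hΩ hi hx (hlim hx)

end Representative

section BallMean

variable {n : ℕ} {x : EuclideanSpace ℝ (Fin n)} {r : ℝ}

theorem ballMean_coe {f : EuclideanSpace ℝ (Fin n) → ℝ} (hi : IntegrableOn f (closedBall x r)) :
    ballMean (fun y => (f y : EReal)) x r = ((⨍ y in closedBall x r, f y : ℝ) : EReal) := by
  have hpos : ∫⁻ y in closedBall x r, ENNReal.ofReal (f y) ≠ ⊤ :=
    ((lintegral_ofReal_le_lintegral_enorm _).trans_lt hi.2).ne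
  have hneg : ∫⁻ y in closedBall x r, ENNReal.ofReal (-f y) ≠ ⊤ :=
    ((lintegral_ofReal_le_lintegral_enorm _).trans_lt hi.neg.2).ne
  rw [ballMean, extIntegral]
  simp only [← EReal.coe_neg, EReal.real_coe_toENNReal]
  rw [setAverage_eq, integral_eq_lintegral_pos_part_sub_lintegral_neg_part hi, smul_eq_mul,
    ← div_eq_inv_mul, EReal.coe_div, EReal.coe_sub, EReal.coe_ennreal_toReal hpos,
    EReal.coe_ennreal_toReal hneg]

theorem ballMean_congr_ae {f g : EuclideanSpace ℝ (Fin n) → EReal}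
    (h : f =ᵐ[volume.restrict (closedBall x r)] g) : ballMean f x r = ballMean g x r := by
  have hpos : (fun y => (f y).toENNReal) =ᵐ[volume.restrict (closedBall x r)]
      fun y => (g y).toENNReal := h.fun_comp EReal.toENNReal
  have hneg : (fun y => (-f y).toENNReal) =ᵐ[volume.restrict (closedBall x r)]
      fun y => (-g y).toENNReal := h.fun_comp fun a => (-a).toENNReal
  rw [ballMean, ballMean, extIntegral, extIntegral, lintegral_congr_ae hpos,
    lintegral_congr_ae hneg]

theorem SubharmonicOn.laplacian_nonneg {u : EuclideanSpace ℝ (Fin n) → ℝ}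
    {U : Set (EuclideanSpace ℝ (Fin n))} (hu : SubharmonicOn (fun y => (u y : EReal)) U)
    (hU : IsOpen U) (hu2 : ContDiffOn ℝ 2 u U) (hx : x ∈ U) : 0 ≤ Δ u x := by
  refine laplacian_nonneg_of_frequently_le_setAverage (hu2.contDiffAt (hU.mem_nhds hx)) ?_
  obtain ⟨δ, hδ, hsub⟩ := nhds_basis_closedBall.mem_iff.1 (hU.mem_nhds hx)
  refine Eventually.frequently ?_
  filter_upwards [Ioc_mem_nhdsGT hδ] with r hr
  have hrU : closedBall x r ⊆ U := (closedBall_subset_closedBall hr.2).trans hsub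
  rw [← EReal.coe_le_coe_iff, ← ballMean_coe
    ((hu2.continuousOn.mono hrU).integrableOn_compact (isCompact_closedBall x r))]
  exact hu.le_ballMean x hx r hr.1 hrU

theorem WeaklySubharmonicOn.subharmonicOn_infBallAverage {f : EuclideanSpace ℝ (Fin n) → ℝ}
    {Ω : Set (EuclideanSpace ℝ (Fin n))} (hf : WeaklySubharmonicOn f Ω) (hΩ : IsOpen Ω)
    (hi : LocallyIntegrableOn f Ω) : SubharmonicOn (infBallAverage volume f Ω) Ω where
  lt_top _ hx := infBallAverage_lt_top hΩ hx
  upperSemicontinuousOn := upperSemicontinuousOn_infBallAverage hΩ hi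
  le_ballMean x _ r hr hsub := by
    have hae : infBallAverage volume f Ω =ᵐ[volume.restrict (closedBall x r)]
        fun y => (f y : EReal) := by
      filter_upwards [ae_restrict_of_ae (hf.ae_infBallAverage_eq hΩ hi),
        ae_restrict_mem measurableSet_closedBall] with y hy hyr
      exact hy (hsub hyr)
    rw [ballMean_congr_ae hae,
      ballMean_coe (hi.integrableOn_compact_subset hsub (isCompact_closedBall x r))]
    exact infBallAverage_le hr hsub
  exists_ne_bot x hx := by
    have hfreq : ∃ᵐ y, y ∈ connectedComponentIn Ω x :=
      frequently_ae_mem_iff.2 (hΩ.connectedComponentIn.measure_pos volume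
        ⟨x, mem_connectedComponentIn hx⟩).ne'
    obtain ⟨y, hy, hyf⟩ := (hfreq.and_eventually (hf.ae_infBallAverage_eq hΩ hi)).exists
    exact ⟨y, hy, hyf (connectedComponentIn_subset Ω x hy) ▸ EReal.coe_ne_bot _⟩

end BallMean

theorem isOpen_diff_of_isClosed_preimage {X : Type*} [TopologicalSpace X] {Ω E : Set X}
    (hΩ : IsOpen Ω) (hE : IsClosed ((Subtype.val : Ω → X) ⁻¹' E)) : IsOpen (Ω \ E) := by
  have hopen := hΩ.isOpenMap_subtype_val _ hE.isOpen_compl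
  rwa [← preimage_compl, Subtype.image_preimage_coe, ← sdiff_eq] at hopen

theorem corollary3_general {n : ℕ} {Ω E : Set (EuclideanSpace ℝ (Fin n))} (hΩ : IsOpen Ω)
    (hE : IsClosed ((Subtype.val : Ω → EuclideanSpace ℝ (Fin n)) ⁻¹' E))
    (hE0 : Measure.hausdorffMeasure ((n : ℝ) - 1) E = 0) {u : EuclideanSpace ℝ (Fin n) → ℝ}
    (hu : SubharmonicOn (fun x => (u x : EReal)) (Ω \ E)) (hu1 : LocallyIntegrableOn u Ω)
    (hu2 : ContDiffOn ℝ 2 u (Ω \ E))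
    (hu3 : ∀ j, LocallyIntegrableOn (partialDeriv j (partialDeriv j u)) Ω) :
    ∃ v : EuclideanSpace ℝ (Fin n) → EReal,
      SubharmonicOn v Ω ∧ ∀ x ∈ Ω \ E, v x = (u x : EReal) := by
  have hU : IsOpen (Ω \ E) := isOpen_diff_of_isClosed_preimage hΩ hE
  have hw : WeaklySubharmonicOn u Ω :=
    weaklySubharmonicOn_of_hausdorffMeasure_eq_zero hΩ hU hE0 hu1 hu2 hu3
      fun x hx => hu.laplacian_nonneg hU hu2 hx
  refine ⟨infBallAverage volume u Ω, hw.subharmonicOn_infBallAverage hΩ hu1, fun x hx => ?_⟩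
  have hi : IntegrableAtFilter u (𝓝 x) := by
    simpa only [hΩ.nhdsWithin_eq hx.1] using hu1 x hx.1
  exact hw.infBallAverage_eq_of_tendsto hΩ hu1 hx.1
    (tendsto_setAverage_closedBall hi (hu2.continuousOn.continuousAt (hU.mem_nhds hx)))

theorem corollary3 (n : ℕ) (hn : 2 ≤ n)
    (Ω : Set (EuclideanSpace ℝ (Fin n))) (hΩo : IsOpen Ω) (hΩc : IsConnected Ω)
    (E : Set (EuclideanSpace ℝ (Fin n))) (hEΩ : E ⊆ Ω)
    (hEc : IsClosed ((Subtype.val : Ω → EuclideanSpace ℝ (Fin n)) ⁻¹' E))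
    (hE0 : Measure.hausdorffMeasure ((n : ℝ) - 1) E = 0)
    (u : EuclideanSpace ℝ (Fin n) → ℝ)
    (hu : SubharmonicOn (fun x => (u x : EReal)) (Ω \ E))
    (hu1 : LocallyIntegrableOn u Ω volume)
    (hu2 : ContDiffOn ℝ 2 u (Ω \ E))
    (hu3 : ∀ j : Fin n, LocallyIntegrableOn (partialDeriv j (partialDeriv j u)) Ω volume) :
    ∃ v : EuclideanSpace ℝ (Fin n) → EReal,
      SubharmonicOn v Ω ∧ ∀ x ∈ Ω \ E, v x = (u x : EReal) :=
  corollary3_general hΩo hEc hE0 hu hu1 hu2 hu3
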